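/- For complex $\nu$ and $\operatorname{Re} z>0$ let $K_\nu(z)=\int_0^\infty e^{-z\cosh y}\cosh(\nu y)\,dy$ be the modified Bessel function of the second kind, and let the Kelvin functions $\mathrm{ker}_\nu,\mathrm{kei}_\nu$ be defined for $x>0$ by the two equalities $$\mathrm{ker}_\nu(x)\pm i\,\mathrm{kei}_\nu(x)=e^{\mp\nu\pi i/2}\,K_\nu\!\left(x e^{\pm\pi i/4}\right).$$ For $x>0$ and $\tau\in\mathbb R$ put $$\mathcal K(x,\tau)=\mathrm{ker}_{2i\tau}^2\!\left(2(4x)^{1/4}\right)+\mathrm{kei}_{2i\tau}^2\!\left(2(4x)^{1/4}\right).$$ Then for each $\tau\in\mathbb R$ the function $x\mapsto\mathcal K(x,\tau)$ is four times continuously differentiable on $(0,\infty)$ and satisfies the fourth-order differential equation $$x^3\frac{d^4\mathcal K}{dx^4}+\frac{11}{2}x^2\frac{d^3\mathcal K}{dx^3}+x\left(\frac{11}{2}+\tau^2\right)\frac{d^2\mathcal K}{dx^2}+\frac12\left(1+\tau^2\right)\frac{d\mathcal K}{dx}-\mathcal K=0,\qquad x>0.$$ Equivalently, $$\left(\frac{d}{dx}\,x^{1/2}\,\frac{d}{dx}\right)\left(\left(x\frac{d}{dx}\right)^2+\tau^2\right)\mathcal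 K(x,\tau)=\frac{1}{\sqrt x}\,\mathcal K(x,\tau),\qquad x>0.$$ -/

import Mathlib

open MeasureTheory Set

noncomputable section

namespace KelvinIndex

/-- The modified Bessel function of the second kind (Macdonald function)
`K_ν(z) = ∫_0^∞ exp (-z cosh y) cosh (ν y) dy`, for `Re z > 0` and any complex index `ν`. -/
def besselK (ν z : ℂ) : ℂ :=
  ∫ y in Ioi (0 : ℝ), Complex.exp (-z * Complex.cosh (y : ℂ)) * Complex.cosh (ν * (y : ℂ))

/-- `ker_ν(x) + i kei_ν(x) = exp (-ν π i / 2) K_ν (x exp (π i / 4))`. -/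
def kelvinPlus (ν : ℂ) (x : ℝ) : ℂ :=
  Complex.exp (-(ν * Real.pi * Complex.I / 2)) *
    besselK ν ((x : ℂ) * Complex.exp (Real.pi * Complex.I / 4))

/-- `ker_ν(x) - i kei_ν(x) = exp (ν π i / 2) K_ν (x exp (-π i / 4))`. -/
def kelvinMinus (ν : ℂ) (x : ℝ) : ℂ :=
  Complex.exp (ν * Real.pi * Complex.I / 2) *
    besselK ν ((x : ℂ) * Complex.exp (-(Real.pi * Complex.I / 4)))

/-- The Kelvin function `ker_ν(x)`, `x > 0`, of complex index `ν` (complex-valued in general). -/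
def ker (ν : ℂ) (x : ℝ) : ℂ :=
  (kelvinPlus ν x + kelvinMinus ν x) / 2

/-- The Kelvin function `kei_ν(x)`, `x > 0`, of complex index `ν` (complex-valued in general). -/
def kei (ν : ℂ) (x : ℝ) : ℂ :=
  (kelvinPlus ν x - kelvinMinus ν x) / (2 * Complex.I)

/-- The kernel `𝒦(x, τ) = ker_{2iτ}(2 (4x)^{1/4})^2 + kei_{2iτ}(2 (4x)^{1/4})^2`, `x > 0`. -/
def kernel (x τ : ℝ) : ℂ :=
  ker (2 * Complex.I * τ) (2 * (4 * x) ^ (1 / 4 : ℝ)) ^ 2 +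
    kei (2 * Complex.I * τ) (2 * (4 * x) ^ (1 / 4 : ℝ)) ^ 2

/-- The operator `x d/dx` on complex-valued functions of a real variable. -/
def eulerOp (f : ℝ → ℂ) : ℝ → ℂ := fun x => (x : ℂ) * deriv f x

/-- The operator `(d/dx) x^{1/2} (d/dx)` on complex-valued functions of a real variable. -/
def sqrtOp (f : ℝ → ℂ) : ℝ → ℂ := deriv (fun x => (Real.sqrt x : ℂ) * deriv f x)

end KelvinIndex

end

/-!
In the variable `y`, the functions `exp (-z cosh y)` and `cosh (ν y)` have a Wronskian that vanishes
at `0` and at `∞`, and whose derivative is the modified Bessel operator in `z` applied to the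
integrand of `K_ν(z)`; integrating it gives the modified Bessel equation. Along a ray
`z = 2 (4x)^{1/4} w` that equation becomes `(x d/dx)² a = (l √x + ν² / 16) a` with `l = w² / 2`.

The kernel is the product `a b` of two such solutions on the rays `w = exp (± π i / 4)`, for which
`l = ± i / 2` have opposite signs. Let `W` be the Wronskian of `a` and `b` with respect to `x d/dx`.
By the Leibniz rule, `x d/dx` maps `((x d/dx)² + τ²) (a b)` to `2 l √x W` and `W` to `-2 l √x a b`,
because the terms free of `l` cancel. As `-4 l² = 1`, this is the factored equation.
-/

namespace KelvinIndex

open Asymptotics Filter Topology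
open scoped ContDiff

/-! ### Estimates for the integrand of `K_ν` -/

theorem one_add_sq_div_two_le_cosh (y : ℝ) : 1 + y ^ 2 / 2 ≤ Real.cosh y := by
  have hsinh : |y / 2| ≤ |Real.sinh (y / 2)| := by
    rw [Real.abs_sinh]
    exact Real.self_le_sinh_iff.2 (abs_nonneg _)
  have hcosh : Real.cosh y = 2 * Real.sinh (y / 2) ^ 2 + 1 := by
    have h := Real.cosh_two_mul (y / 2)
    rw [mul_div_cancel₀ y two_ne_zero, Real.cosh_sq] at h
    linarith
  linarith [sq_le_sq.2 hsinh]

theorem neg_mul_cosh_add_mul_le {r : ℝ} (hr : 0 < r) (m y : ℝ) :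
    -r * Real.cosh y + m * y ≤ (m + 1) ^ 2 / (2 * r) - y := by
  have hsq : (m + 1) ^ 2 / (2 * r) - (m + 1) * y + r * (y ^ 2 / 2) =
      (m + 1 - r * y) ^ 2 / (2 * r) := by
    field_simp
    ring
  have hnonneg : 0 ≤ (m + 1 - r * y) ^ 2 / (2 * r) := by positivity
  nlinarith [mul_le_mul_of_nonneg_left (one_add_sq_div_two_le_cosh y) hr.le]

theorem exp_neg_mul_cosh_add_mul_isBigO {r : ℝ} (hr : 0 < r) (m : ℝ) :
    (fun y : ℝ => Real.exp (-r * Real.cosh y + m * y)) =O[atTop] fun y => Real.exp (-y) := by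
  refine IsBigO.of_bound (Real.exp ((m + 1) ^ 2 / (2 * r))) (Eventually.of_forall fun y => ?_)
  rw [Real.norm_of_nonneg (Real.exp_pos _).le, Real.norm_of_nonneg (Real.exp_pos _).le,
    ← Real.exp_add, Real.exp_le_exp]
  exact neg_mul_cosh_add_mul_le hr m y

theorem integrableOn_exp_neg_mul_cosh_add_mul {r : ℝ} (hr : 0 < r) (m : ℝ) :
    IntegrableOn (fun y : ℝ => Real.exp (-r * Real.cosh y + m * y)) (Ioi 0) :=
  integrable_of_isBigO_exp_neg one_pos (by fun_prop)
    (by simpa only [neg_mul, one_mul] using exp_neg_mul_cosh_add_mul_isBigO hr m)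

theorem tendsto_exp_neg_mul_cosh_add_mul {r : ℝ} (hr : 0 < r) (m : ℝ) :
    Tendsto (fun y : ℝ => Real.exp (-r * Real.cosh y + m * y)) atTop (𝓝 0) :=
  (exp_neg_mul_cosh_add_mul_isBigO hr m).trans_tendsto Real.tendsto_exp_neg_atTop_nhds_zero

theorem norm_cosh_le_exp_norm (z : ℂ) : ‖Complex.cosh z‖ ≤ Real.exp ‖z‖ := by
  have hneg := Complex.norm_exp_le_exp_norm (-z)
  rw [norm_neg] at hneg
  rw [Complex.cosh, norm_div, Complex.norm_ofNat]
  linarith [norm_add_le (Complex.exp z) (Complex.exp (-z)), Complex.norm_exp_le_exp_norm z]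

theorem norm_sinh_le_exp_norm (z : ℂ) : ‖Complex.sinh z‖ ≤ Real.exp ‖z‖ := by
  have hneg := Complex.norm_exp_le_exp_norm (-z)
  rw [norm_neg] at hneg
  rw [Complex.sinh, norm_div, Complex.norm_ofNat]
  linarith [norm_sub_le (Complex.exp z) (Complex.exp (-z)), Complex.norm_exp_le_exp_norm z]

theorem norm_exp_neg_mul_cosh (z : ℂ) (y : ℝ) :
    ‖Complex.exp (-z * Complex.cosh y)‖ = Real.exp (-z.re * Real.cosh y) := by
  rw [Complex.norm_exp, ← Complex.ofReal_cosh, Complex.re_mul_ofReal, Complex.neg_re]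

theorem norm_mul_ofReal_of_nonneg (ν : ℂ) {y : ℝ} (hy : 0 ≤ y) : ‖ν * (y : ℂ)‖ = ‖ν‖ * y := by
  rw [norm_mul, Complex.norm_of_nonneg hy]

/-! ### Moments and the modified Bessel equation -/

/-- The integrand of the moment `besselMoment ν n z`; for `n = 0` it is that of `K_ν(z)`. -/
noncomputable def besselIntegrand (ν : ℂ) (n : ℕ) (z : ℂ) (y : ℝ) : ℂ :=
  Complex.cosh y ^ n * (Complex.exp (-z * Complex.cosh y) * Complex.cosh (ν * y))

/-- The `n`-th `cosh`-moment of the integral defining `K_ν(z)`, which is `(-1)^n` times the `n`-th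
derivative of `K_ν` at `z`. -/
noncomputable def besselMoment (ν : ℂ) (n : ℕ) (z : ℂ) : ℂ :=
  ∫ y in Ioi (0 : ℝ), besselIntegrand ν n z y

/-- The Wronskian `e' c - e c'` of `e(y) = exp (-z cosh y)` and `c(y) = cosh (ν y)`, the
antiderivative that yields the modified Bessel equation. -/
noncomputable def besselWronskian (ν z : ℂ) (y : ℝ) : ℂ :=
  -(Complex.exp (-z * Complex.cosh y) *
    (z * Complex.sinh y * Complex.cosh (ν * y) + ν * Complex.sinh (ν * y)))

theorem continuous_besselIntegrand (ν : ℂ) (n : ℕ) (z : ℂ) :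
    Continuous (besselIntegrand ν n z) := by
  unfold besselIntegrand
  fun_prop

theorem norm_besselIntegrand_le (ν : ℂ) (n : ℕ) {z : ℂ} {r y : ℝ} (hz : r ≤ z.re)
    (hy : 0 ≤ y) :
    ‖besselIntegrand ν n z y‖ ≤ Real.exp (-r * Real.cosh y + (n + ‖ν‖) * y) := by
  have hpow : ‖Complex.cosh y‖ ^ n ≤ Real.exp (n * y) := by
    rw [Real.exp_nat_mul]
    gcongr
    simpa [abs_of_nonneg hy] using norm_cosh_le_exp_norm y
  have hcosh : ‖Complex.cosh (ν * y)‖ ≤ Real.exp (‖ν‖ * y) :=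
    norm_mul_ofReal_of_nonneg ν hy ▸ norm_cosh_le_exp_norm (ν * y)
  have hexp : Real.exp (-z.re * Real.cosh y) ≤ Real.exp (-r * Real.cosh y) := by
    have := Real.cosh_pos y
    gcongr
  calc ‖besselIntegrand ν n z y‖
      = ‖Complex.cosh y‖ ^ n * (Real.exp (-z.re * Real.cosh y) * ‖Complex.cosh (ν * y)‖) := by
        rw [besselIntegrand, norm_mul, norm_mul, norm_pow, norm_exp_neg_mul_cosh]
    _ ≤ Real.exp (n * y) * (Real.exp (-r * Real.cosh y) * Real.exp (‖ν‖ * y)) := by gcongr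
    _ = Real.exp (-r * Real.cosh y + (n + ‖ν‖) * y) := by
        rw [← Real.exp_add, ← Real.exp_add]
        ring_nf

theorem integrableOn_besselIntegrand (ν : ℂ) (n : ℕ) {z : ℂ} (hz : 0 < z.re) :
    IntegrableOn (besselIntegrand ν n z) (Ioi 0) := by
  refine Integrable.mono' (integrableOn_exp_neg_mul_cosh_add_mul hz (n + ‖ν‖))
    (continuous_besselIntegrand ν n z).aestronglyMeasurable ?_
  filter_upwards [ae_restrict_mem measurableSet_Ioi] with y hy
  exact norm_besselIntegrand_le ν n le_rfl (le_of_lt hy)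

theorem hasDerivAt_besselIntegrand (ν : ℂ) (n : ℕ) (z : ℂ) (y : ℝ) :
    HasDerivAt (fun w => besselIntegrand ν n w y) (-besselIntegrand ν (n + 1) z y) z := by
  have h := ((hasDerivAt_neg z).mul_const (Complex.cosh y)).cexp.mul_const
    (Complex.cosh (ν * y)) |>.const_mul (Complex.cosh y ^ n)
  refine h.congr_deriv ?_
  rw [besselIntegrand]
  ring

theorem hasDerivAt_besselMoment (ν : ℂ) (n : ℕ) {z : ℂ} (hz : 0 < z.re) :
    HasDerivAt (besselMoment ν n) (-besselMoment ν (n + 1) z) z := by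
  have hs : {w : ℂ | z.re / 2 < w.re} ∈ 𝓝 z :=
    (isOpen_lt continuous_const Complex.continuous_re).mem_nhds (half_lt_self hz)
  have hbound : ∀ᵐ y ∂volume.restrict (Ioi (0 : ℝ)), ∀ w ∈ {w : ℂ | z.re / 2 < w.re},
      ‖-besselIntegrand ν (n + 1) w y‖ ≤
        Real.exp (-(z.re / 2) * Real.cosh y + ((n + 1 : ℕ) + ‖ν‖) * y) := by
    filter_upwards [ae_restrict_mem measurableSet_Ioi] with y hy w hw
    rw [norm_neg]
    exact norm_besselIntegrand_le ν (n + 1) (le_of_lt hw) (le_of_lt hy)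
  have h := (hasDerivAt_integral_of_dominated_loc_of_deriv_le hs
    (Eventually.of_forall fun w => (continuous_besselIntegrand ν n w).aestronglyMeasurable)
    (integrableOn_besselIntegrand ν n hz)
    (continuous_besselIntegrand ν (n + 1) z).neg.aestronglyMeasurable hbound
    (integrableOn_exp_neg_mul_cosh_add_mul (half_pos hz) _)
    (Eventually.of_forall fun y w _ => hasDerivAt_besselIntegrand ν n w y)).2
  rwa [integral_neg] at h

theorem hasDerivAt_besselWronskian (ν z : ℂ) (y : ℝ) :
    HasDerivAt (besselWronskian ν z)
      (z ^ 2 * besselIntegrand ν 2 z y - z * besselIntegrand ν 1 z y -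
        (z ^ 2 + ν ^ 2) * besselIntegrand ν 0 z y) y := by
  have hid : HasDerivAt (fun w : ℂ => w) 1 y := hasDerivAt_id' _
  have hν := hid.const_mul ν
  have h := (((hid.ccosh.const_mul (-z)).cexp).mul
    (((hid.csinh.const_mul z).mul hν.ccosh).add (hν.csinh.const_mul ν))).neg
  refine h.comp_ofReal.congr_deriv ?_
  simp only [besselIntegrand, Pi.add_apply, Pi.mul_apply]
  linear_combination (-z ^ 2 * Complex.exp (-z * Complex.cosh y) * Complex.cosh (ν * y)) *
    Complex.cosh_sq_sub_sinh_sq (y : ℂ)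

theorem besselWronskian_zero (ν z : ℂ) : besselWronskian ν z 0 = 0 := by
  simp [besselWronskian]

theorem norm_besselWronskian_le (ν z : ℂ) {y : ℝ} (hy : 0 ≤ y) :
    ‖besselWronskian ν z y‖ ≤
      (‖z‖ + ‖ν‖) * Real.exp (-z.re * Real.cosh y + (1 + ‖ν‖) * y) := by
  have hsinh : ‖Complex.sinh y‖ ≤ Real.exp y := by
    simpa [abs_of_nonneg hy] using norm_sinh_le_exp_norm y
  have hcosh_mul : ‖Complex.cosh (ν * y)‖ ≤ Real.exp (‖ν‖ * y) :=
    norm_mul_ofReal_of_nonneg ν hy ▸ norm_cosh_le_exp_norm (ν * y)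
  have hsinh_mul : ‖Complex.sinh (ν * y)‖ ≤ Real.exp y * Real.exp (‖ν‖ * y) :=
    (norm_mul_ofReal_of_nonneg ν hy ▸ norm_sinh_le_exp_norm (ν * y)).trans
      (le_mul_of_one_le_left (Real.exp_pos _).le (Real.one_le_exp hy))
  calc ‖besselWronskian ν z y‖
      ≤ Real.exp (-z.re * Real.cosh y) * (‖z‖ * ‖Complex.sinh y‖ * ‖Complex.cosh (ν * y)‖ +
          ‖ν‖ * ‖Complex.sinh (ν * y)‖) := by
        rw [besselWronskian, norm_neg, norm_mul, norm_exp_neg_mul_cosh, ← norm_mul, ← norm_mul,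
          ← norm_mul]
        gcongr
        exact norm_add_le _ _
    _ ≤ Real.exp (-z.re * Real.cosh y) * (‖z‖ * Real.exp y * Real.exp (‖ν‖ * y) +
          ‖ν‖ * (Real.exp y * Real.exp (‖ν‖ * y))) := by gcongr
    _ = (‖z‖ + ‖ν‖) * Real.exp (-z.re * Real.cosh y + (1 + ‖ν‖) * y) := by
        rw [add_mul 1, one_mul, Real.exp_add, Real.exp_add]
        ring

theorem tendsto_besselWronskian (ν : ℂ) {z : ℂ} (hz : 0 < z.re) :
    Tendsto (besselWronskian ν z) atTop (𝓝 0) := by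
  have h := (tendsto_exp_neg_mul_cosh_add_mul hz (1 + ‖ν‖)).const_mul (‖z‖ + ‖ν‖)
  rw [mul_zero] at h
  refine squeeze_zero_norm' ?_ h
  filter_upwards [eventually_ge_atTop 0] with y hy using norm_besselWronskian_le ν z hy

theorem besselMoment_equation (ν : ℂ) {z : ℂ} (hz : 0 < z.re) :
    z ^ 2 * besselMoment ν 2 z - z * besselMoment ν 1 z = (z ^ 2 + ν ^ 2) * besselMoment ν 0 z := by
  have hint (n : ℕ) (p : ℂ) : IntegrableOn (fun y => p * besselIntegrand ν n z y) (Ioi 0) :=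
    (integrableOn_besselIntegrand ν n hz).const_mul p
  have hint₂₁ : IntegrableOn
      (fun y => z ^ 2 * besselIntegrand ν 2 z y - z * besselIntegrand ν 1 z y) (Ioi 0) :=
    (hint 2 _).sub (hint 1 _)
  have h := integral_Ioi_of_hasDerivAt_of_tendsto'
    (fun y _ => hasDerivAt_besselWronskian ν z y) (hint₂₁.sub (hint 0 _))
    (tendsto_besselWronskian ν hz)
  rw [integral_sub hint₂₁ (hint 0 _), integral_sub (hint 2 _) (hint 1 _), integral_const_mul,
    integral_const_mul, integral_const_mul, besselWronskian_zero, sub_zero] at h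
  exact sub_eq_zero.1 h

theorem besselMoment_zero (ν : ℂ) : besselMoment ν 0 = besselK ν := by
  funext z
  simp only [besselMoment, besselIntegrand, besselK, pow_zero, one_mul]

theorem hasDerivAt_besselK (ν : ℂ) {z : ℂ} (hz : 0 < z.re) :
    HasDerivAt (besselK ν) (-besselMoment ν 1 z) z :=
  besselMoment_zero ν ▸ hasDerivAt_besselMoment ν 0 hz

theorem contDiffAt_besselK (ν : ℂ) {z : ℂ} (hz : 0 < z.re) : ContDiffAt ℂ ω (besselK ν) z := by
  have hd : DifferentiableOn ℂ (besselK ν) {z | 0 < z.re} := fun z hz =>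
    (hasDerivAt_besselK ν hz).differentiableAt.differentiableWithinAt
  exact (hd.analyticAt
    ((isOpen_lt continuous_const Complex.continuous_re).mem_nhds hz)).contDiffAt

/-! ### The operators `x d/dx` and `(d/dx) x^{1/2} (d/dx)` -/

section Operators

variable {f g : ℝ → ℂ} {x : ℝ}

theorem hasDerivAt_eulerOp_div (hf : DifferentiableAt ℝ f x) (hx : x ≠ 0) :
    HasDerivAt f (eulerOp f x / x) x := by
  rw [eulerOp, mul_div_cancel_left₀ _ (Complex.ofReal_ne_zero.2 hx)]
  exact hf.hasDerivAt

theorem eulerOp_mul (hf : DifferentiableAt ℝ f x) (hg : DifferentiableAt ℝ g x) :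
    eulerOp (fun t => f t * g t) x = eulerOp f x * g x + f x * eulerOp g x := by
  rw [eulerOp, deriv_fun_mul hf hg, eulerOp, eulerOp]
  ring

theorem eulerOp_add (hf : DifferentiableAt ℝ f x) (hg : DifferentiableAt ℝ g x) :
    eulerOp (fun t => f t + g t) x = eulerOp f x + eulerOp g x := by
  rw [eulerOp, deriv_fun_add hf hg, mul_add, eulerOp, eulerOp]

theorem eulerOp_sub (hf : DifferentiableAt ℝ f x) (hg : DifferentiableAt ℝ g x) :
    eulerOp (fun t => f t - g t) x = eulerOp f x - eulerOp g x := by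
  rw [eulerOp, deriv_fun_sub hf hg, mul_sub, eulerOp, eulerOp]

theorem eulerOp_const_mul (c : ℂ) (f : ℝ → ℂ) (x : ℝ) :
    eulerOp (fun t => c * f t) x = c * eulerOp f x := by
  rw [eulerOp, deriv_const_mul_field, eulerOp, mul_left_comm]

theorem eulerOp_congr (h : EqOn f g (Ioi 0)) : EqOn (eulerOp f) (eulerOp g) (Ioi 0) :=
  fun x hx => by rw [eulerOp, eulerOp, (h.eventuallyEq_of_mem (Ioi_mem_nhds hx)).deriv_eq]

theorem contDiffOn_eulerOp {n : WithTop ℕ∞} (hf : ContDiffOn ℝ (n + 1) f (Ioi 0)) :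
    ContDiffOn ℝ n (eulerOp f) (Ioi 0) :=
  Complex.ofRealCLM.contDiff.contDiffOn.mul (hf.deriv_of_isOpen isOpen_Ioi le_rfl)

theorem sqrtOp_eq_deriv_eulerOp_div_sqrt (f : ℝ → ℂ) :
    sqrtOp f = deriv fun t => eulerOp f t / (√t : ℂ) := by
  refine congrArg deriv (funext fun t => ?_)
  rw [eulerOp, mul_div_right_comm, ← Complex.ofReal_div, Real.div_sqrt]

theorem ofReal_sqrt_sq (hx : 0 ≤ x) : (√x : ℂ) ^ 2 = x := by
  exact_mod_cast Real.sq_sqrt hx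

theorem ofReal_sqrt_ne_zero (hx : 0 < x) : (√x : ℂ) ≠ 0 :=
  Complex.ofReal_ne_zero.2 (Real.sqrt_ne_zero'.2 hx)

theorem sqrt_mul_sqrtOp (hf : DifferentiableAt ℝ (deriv f) x) (hx : 0 < x) :
    (√x : ℂ) * sqrtOp f x = x * deriv (deriv f) x + deriv f x / 2 := by
  have h := (Real.hasDerivAt_sqrt hx.ne').ofReal_comp.mul hf.hasDerivAt
  have hs := ofReal_sqrt_ne_zero hx
  rw [show sqrtOp f x = _ from h.deriv, ← ofReal_sqrt_sq hx.le]
  push_cast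
  field_simp
  ring

theorem hasDerivAt_iteratedDeriv {n k : ℕ} (hf : ContDiffAt ℝ n f x) (hk : k < n) :
    HasDerivAt (iteratedDeriv k f) (iteratedDeriv (k + 1) f x) x := by
  have hd := hf.contDiffWithinAt (s := univ) |>.differentiableWithinAt_iteratedDerivWithin (m := k)
    (by exact_mod_cast hk) (by simp only [mem_univ, insert_eq_of_mem, uniqueDiffOn_univ])
  rw [differentiableWithinAt_univ, iteratedDerivWithin_univ] at hd
  rw [iteratedDeriv_succ]
  exact hd.hasDerivAt

theorem eulerOp_eulerOp (hf : DifferentiableAt ℝ (deriv f) x) :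
    eulerOp (eulerOp f) x = (x : ℂ) ^ 2 * iteratedDeriv 2 f x + x * iteratedDeriv 1 f x := by
  have h := (hasDerivAt_id' x).ofReal_comp.mul hf.hasDerivAt
  rw [eulerOp, show deriv (eulerOp f) x = _ from h.deriv, iteratedDeriv_succ, iteratedDeriv_one]
  push_cast
  ring

theorem differentiableAt_of_contDiffOn_two (hf : ContDiffOn ℝ 2 f (Ioi 0)) (hx : 0 < x) :
    DifferentiableAt ℝ f x :=
  (hf.contDiffAt (Ioi_mem_nhds hx)).differentiableAt two_ne_zero

theorem differentiableAt_eulerOp (hf : ContDiffOn ℝ 2 f (Ioi 0)) (hx : 0 < x) :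
    DifferentiableAt ℝ (eulerOp f) x :=
  ((contDiffOn_eulerOp (n := 1) (by rwa [one_add_one_eq_two])).contDiffAt
    (Ioi_mem_nhds hx)).differentiableAt one_ne_zero

theorem hasDerivAt_eulerOp_eulerOp_add_const_mul (hf : ContDiffOn ℝ 3 f (Ioi 0)) (c : ℂ)
    (hx : 0 < x) :
    HasDerivAt (fun t => eulerOp (eulerOp f) t + c * f t)
      ((x : ℂ) ^ 2 * iteratedDeriv 3 f x + 3 * (x * iteratedDeriv 2 f x) +
        (1 + c) * iteratedDeriv 1 f x) x := by
  have hd {k : ℕ} (hk : k < 3) {t : ℝ} (ht : 0 < t) :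
      HasDerivAt (iteratedDeriv k f) (iteratedDeriv (k + 1) f t) t :=
    hasDerivAt_iteratedDeriv (n := 3) (hf.contDiffAt (Ioi_mem_nhds ht)) hk
  have hid : HasDerivAt (fun t : ℝ => (t : ℂ)) 1 x := (hasDerivAt_id' x).ofReal_comp
  have h := (((hid.fun_pow 2).fun_mul (hd (k := 2) (by norm_num) hx)).fun_add
    (hid.fun_mul (hd (k := 1) (by norm_num) hx))).fun_add
      ((hd (k := 0) (by norm_num) hx).const_mul c)
  refine (h.congr_of_eventuallyEq ?_).congr_deriv ?_
  · filter_upwards [Ioi_mem_nhds hx] with t ht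
    have hf₁ := (hd (k := 1) (by norm_num) ht).differentiableAt
    rw [iteratedDeriv_one] at hf₁
    rw [eulerOp_eulerOp hf₁, iteratedDeriv_zero]
  · push_cast
    ring

theorem sqrt_mul_sqrtOp_eulerOp_eulerOp (hf : ContDiffOn ℝ 4 f (Ioi 0)) (c : ℂ) (hx : 0 < x) :
    (√x : ℂ) * sqrtOp (fun t => eulerOp (eulerOp f) t + c * f t) x =
      (x : ℂ) ^ 3 * iteratedDeriv 4 f x + (11 / 2 : ℂ) * (x : ℂ) ^ 2 * iteratedDeriv 3 f x
        + (x : ℂ) * (11 / 2 + c) * iteratedDeriv 2 f x + (1 / 2 : ℂ) * (1 + c) * deriv f x := by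
  have hd {k : ℕ} (hk : k < 4) : HasDerivAt (iteratedDeriv k f) (iteratedDeriv (k + 1) f x) x :=
    hasDerivAt_iteratedDeriv (n := 4) (hf.contDiffAt (Ioi_mem_nhds hx)) hk
  have hid : HasDerivAt (fun t : ℝ => (t : ℂ)) 1 x := (hasDerivAt_id' x).ofReal_comp
  have hderiv : EqOn (deriv fun t => eulerOp (eulerOp f) t + c * f t)
      (fun t => (t : ℂ) ^ 2 * iteratedDeriv 3 f t + 3 * (t * iteratedDeriv 2 f t) +
        (1 + c) * iteratedDeriv 1 f t) (Ioi 0) := fun t ht =>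
    (hasDerivAt_eulerOp_eulerOp_add_const_mul (hf.of_le (by norm_num)) c ht).deriv
  have hderiv₂ := (((hid.fun_pow 2).fun_mul (hd (k := 3) (by norm_num))).fun_add
    ((hid.fun_mul (hd (k := 2) (by norm_num))).const_mul 3)).fun_add
      ((hd (k := 1) (by norm_num)).const_mul (1 + c))
    |>.congr_of_eventuallyEq (hderiv.eventuallyEq_of_mem (Ioi_mem_nhds hx))
  rw [sqrt_mul_sqrtOp hderiv₂.differentiableAt hx, hderiv₂.deriv, hderiv hx, ← iteratedDeriv_one]
  push_cast
  ring

end Operators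

/-! ### Products of solutions of `(x d/dx)² a = (± l √x - c / 4) a` -/

/-- The Wronskian of two functions with respect to `x d/dx` in place of `d/dx`, to suit equations
written in terms of `x d/dx`. -/
noncomputable def eulerWronskian (a b : ℝ → ℂ) (x : ℝ) : ℂ :=
  a x * eulerOp b x - eulerOp a x * b x

section Product

variable {a b : ℝ → ℂ} {l c : ℂ} {x : ℝ}

theorem eulerOp_eulerOp_mul (ha : ContDiffOn ℝ 2 a (Ioi 0)) (hb : ContDiffOn ℝ 2 b (Ioi 0))
    (hx : 0 < x) :
    eulerOp (eulerOp fun t => a t * b t) x =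
      eulerOp (eulerOp a) x * b x + 2 * (eulerOp a x * eulerOp b x) +
        a x * eulerOp (eulerOp b) x := by
  have hab : EqOn (eulerOp fun t => a t * b t) (fun t => eulerOp a t * b t + a t * eulerOp b t)
      (Ioi 0) := fun t ht =>
    eulerOp_mul (differentiableAt_of_contDiffOn_two ha ht)
      (differentiableAt_of_contDiffOn_two hb ht)
  have ha₀ := differentiableAt_of_contDiffOn_two ha hx
  have hb₀ := differentiableAt_of_contDiffOn_two hb hx
  have ha₁ := differentiableAt_eulerOp ha hx
  have hb₁ := differentiableAt_eulerOp hb hx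
  rw [eulerOp_congr hab hx, eulerOp_add (ha₁.fun_mul hb₀) (ha₀.fun_mul hb₁),
    eulerOp_mul ha₁ hb₀, eulerOp_mul ha₀ hb₁]
  ring

theorem differentiableAt_eulerWronskian (ha : ContDiffOn ℝ 2 a (Ioi 0))
    (hb : ContDiffOn ℝ 2 b (Ioi 0)) (hx : 0 < x) : DifferentiableAt ℝ (eulerWronskian a b) x :=
  ((differentiableAt_of_contDiffOn_two ha hx).mul (differentiableAt_eulerOp hb hx)).sub
    ((differentiableAt_eulerOp ha hx).mul (differentiableAt_of_contDiffOn_two hb hx))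

theorem eulerOp_eulerWronskian (ha : ContDiffOn ℝ 2 a (Ioi 0)) (hb : ContDiffOn ℝ 2 b (Ioi 0))
    (hx : 0 < x) :
    eulerOp (eulerWronskian a b) x =
      a x * eulerOp (eulerOp b) x - eulerOp (eulerOp a) x * b x := by
  have ha₀ := differentiableAt_of_contDiffOn_two ha hx
  have hb₀ := differentiableAt_of_contDiffOn_two hb hx
  have ha₁ := differentiableAt_eulerOp ha hx
  have hb₁ := differentiableAt_eulerOp hb hx
  unfold eulerWronskian
  rw [eulerOp_sub (ha₀.fun_mul hb₁) (ha₁.fun_mul hb₀), eulerOp_mul ha₀ hb₁, eulerOp_mul ha₁ hb₀]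
  ring

theorem eulerOp_eulerOp_eulerOp_mul_add_const_mul
    (ha : ContDiffOn ℝ 2 a (Ioi 0)) (hb : ContDiffOn ℝ 2 b (Ioi 0))
    (ha_eq : ∀ t : ℝ, 0 < t → eulerOp (eulerOp a) t = (l * √t - c / 4) * a t)
    (hb_eq : ∀ t : ℝ, 0 < t → eulerOp (eulerOp b) t = (-l * √t - c / 4) * b t) (hx : 0 < x) :
    eulerOp (fun t => eulerOp (eulerOp fun u => a u * b u) t + c * (a t * b t)) x =
      2 * l * √x * eulerWronskian a b x := by
  have hab : EqOn (fun t => eulerOp (eulerOp fun u => a u * b u) t + c * (a t * b t))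
      (fun t => 2 * (eulerOp a t * eulerOp b t) + c / 2 * (a t * b t)) (Ioi 0) := fun t ht => by
    simp only [eulerOp_eulerOp_mul ha hb ht, ha_eq t ht, hb_eq t ht]
    ring
  have ha₀ := differentiableAt_of_contDiffOn_two ha hx
  have hb₀ := differentiableAt_of_contDiffOn_two hb hx
  have ha₁ := differentiableAt_eulerOp ha hx
  have hb₁ := differentiableAt_eulerOp hb hx
  rw [eulerOp_congr hab hx, eulerOp_add ((ha₁.fun_mul hb₁).const_mul 2)
    ((ha₀.fun_mul hb₀).const_mul (c / 2)), eulerOp_const_mul, eulerOp_const_mul,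
    eulerOp_mul ha₁ hb₁, eulerOp_mul ha₀ hb₀, ha_eq x hx, hb_eq x hx, eulerWronskian]
  ring

theorem sqrtOp_eulerOp_eulerOp_mul
    (ha : ContDiffOn ℝ 2 a (Ioi 0)) (hb : ContDiffOn ℝ 2 b (Ioi 0))
    (ha_eq : ∀ t : ℝ, 0 < t → eulerOp (eulerOp a) t = (l * √t - c / 4) * a t)
    (hb_eq : ∀ t : ℝ, 0 < t → eulerOp (eulerOp b) t = (-l * √t - c / 4) * b t) (hx : 0 < x) :
    sqrtOp (fun t => eulerOp (eulerOp fun u => a u * b u) t + c * (a t * b t)) x =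
      -4 * l ^ 2 * (a x * b x) / √x := by
  have hW : EqOn
      (fun t => eulerOp (fun t => eulerOp (eulerOp fun u => a u * b u) t + c * (a t * b t)) t / √t)
      (fun t => 2 * l * eulerWronskian a b t) (Ioi 0) := fun t ht => by
    have hs := ofReal_sqrt_ne_zero ht
    simp only [eulerOp_eulerOp_eulerOp_mul_add_const_mul ha hb ha_eq hb_eq ht]
    field_simp
  have hW_deriv := (hasDerivAt_eulerOp_div (differentiableAt_eulerWronskian ha hb hx)
    hx.ne').const_mul (2 * l)
  have hs := ofReal_sqrt_ne_zero hx
  rw [sqrtOp_eq_deriv_eulerOp_div_sqrt, (hW.eventuallyEq_of_mem (Ioi_mem_nhds hx)).deriv_eq,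
    hW_deriv.deriv, eulerOp_eulerWronskian ha hb hx, ha_eq x hx, hb_eq x hx,
    ← ofReal_sqrt_sq hx.le]
  field_simp
  ring

end Product

/-! ### Macdonald functions on rays and the kernel -/

/-- The argument `2 (4x)^{1/4}` at which the kernel evaluates the Kelvin functions. -/
noncomputable def kelvinArg (x : ℝ) : ℝ := 2 * (4 * x) ^ (1 / 4 : ℝ)

/-- The Macdonald function `K_ν(2 (4x)^{1/4} w)` along the ray of direction `w`, parametrized so
that the modified Bessel equation becomes an equation in `x d/dx`. -/
noncomputable def besselKOnRay (ν w : ℂ) (x : ℝ) : ℂ := besselK ν (kelvinArg x * w)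

/-- The kernel `𝒦(x, τ)` for a complex parameter `τ`, that is, for Kelvin functions of arbitrary
complex index `2iτ`. The parameter comes first, so that `complexKernel τ` is a function of `x`. -/
noncomputable def complexKernel (τ : ℂ) (x : ℝ) : ℂ :=
  ker (2 * Complex.I * τ) (kelvinArg x) ^ 2 + kei (2 * Complex.I * τ) (kelvinArg x) ^ 2

theorem kelvinArg_pos {x : ℝ} (hx : 0 < x) : 0 < kelvinArg x := by
  unfold kelvinArg
  positivity

theorem kelvinArg_sq {x : ℝ} (hx : 0 ≤ x) : kelvinArg x ^ 2 = 8 * √x := by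
  have hsqrt : √(4 * x) = 2 * √x := by
    rw [Real.sqrt_mul zero_le_four, show (4 : ℝ) = 2 ^ 2 by norm_num, Real.sqrt_sq zero_le_two]
  rw [kelvinArg, mul_pow, ← Real.rpow_mul_natCast (by positivity),
    show (1 / 4 : ℝ) * (2 : ℕ) = 1 / 2 by norm_num, ← Real.sqrt_eq_rpow, hsqrt]
  ring

theorem contDiffAt_kelvinArg {x : ℝ} (hx : x ≠ 0) : ContDiffAt ℝ ω kelvinArg x :=
  contDiffAt_const.mul
    ((contDiffAt_const.mul contDiffAt_id).rpow_const_of_ne (mul_ne_zero four_ne_zero hx))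

theorem hasDerivAt_kelvinArg {x : ℝ} (hx : x ≠ 0) :
    HasDerivAt kelvinArg (kelvinArg x / (4 * x)) x := by
  have h := (((hasDerivAt_id' x).const_mul 4).rpow_const (p := 1 / 4)
    (Or.inl (mul_ne_zero four_ne_zero hx))).const_mul 2
  refine h.congr_deriv ?_
  rw [Real.rpow_sub_one (mul_ne_zero four_ne_zero hx), kelvinArg]
  field_simp

theorem re_kelvinArg_mul_pos {w : ℂ} (hw : 0 < w.re) {x : ℝ} (hx : 0 < x) :
    0 < ((kelvinArg x : ℂ) * w).re := by
  rw [Complex.re_ofReal_mul]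
  exact mul_pos (kelvinArg_pos hx) hw

theorem eulerOp_comp_kelvinArg_mul {F : ℂ → ℂ} {F' w : ℂ} {x : ℝ} (hx : x ≠ 0)
    (hF : HasDerivAt F F' (kelvinArg x * w)) :
    eulerOp (fun t => F (kelvinArg t * w)) x = kelvinArg x * w * F' / 4 := by
  have hx_ne : (x : ℂ) ≠ 0 := Complex.ofReal_ne_zero.2 hx
  have h := hF.comp x ((hasDerivAt_kelvinArg hx).ofReal_comp.mul_const w)
  rw [eulerOp, show deriv (fun t => F (kelvinArg t * w)) x = _ from h.deriv]
  push_cast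
  field_simp

theorem eulerOp_eulerOp_besselKOnRay (ν : ℂ) {w : ℂ} (hw : 0 < w.re) {x : ℝ} (hx : 0 < x) :
    eulerOp (eulerOp (besselKOnRay ν w)) x =
      (w ^ 2 / 2 * √x + ν ^ 2 / 16) * besselKOnRay ν w x := by
  have hfirst : EqOn (eulerOp (besselKOnRay ν w))
      (fun t => (fun z => z * -besselMoment ν 1 z / 4) (kelvinArg t * w)) (Ioi 0) := fun t ht =>
    eulerOp_comp_kelvinArg_mul (ne_of_gt ht) (hasDerivAt_besselK ν (re_kelvinArg_mul_pos hw ht))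
  have hz := re_kelvinArg_mul_pos hw hx
  have hsq : (kelvinArg x : ℂ) ^ 2 = 8 * √x := by exact_mod_cast kelvinArg_sq hx.le
  have hsecond :=
    ((hasDerivAt_id' _).fun_mul (hasDerivAt_besselMoment ν 1 hz).fun_neg).div_const 4
  have hbessel := besselMoment_equation ν hz
  rw [besselMoment_zero] at hbessel
  rw [eulerOp_congr hfirst hx, eulerOp_comp_kelvinArg_mul hx.ne' hsecond, besselKOnRay]
  linear_combination hbessel / 16 + w ^ 2 / 16 * besselK ν (kelvinArg x * w) * hsq

theorem contDiffOn_besselKOnRay (ν : ℂ) {w : ℂ} (hw : 0 < w.re) :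
    ContDiffOn ℝ ω (besselKOnRay ν w) (Ioi 0) := fun x hx =>
  (ContDiffAt.comp (g := besselK ν) (f := fun t => (kelvinArg t : ℂ) * w) x
    ((contDiffAt_besselK ν (re_kelvinArg_mul_pos hw hx)).restrict_scalars ℝ)
    ((Complex.ofRealCLM.contDiff.contDiffAt.comp x (contDiffAt_kelvinArg (ne_of_gt hx))).mul
      contDiffAt_const)).contDiffWithinAt

theorem ker_sq_add_kei_sq (ν : ℂ) (x : ℝ) :
    ker ν x ^ 2 + kei ν x ^ 2 = kelvinPlus ν x * kelvinMinus ν x := by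
  rw [ker, kei, div_pow, div_pow, mul_pow, Complex.I_sq]
  ring

theorem kelvinPlus_mul_kelvinMinus (ν : ℂ) (x : ℝ) :
    kelvinPlus ν x * kelvinMinus ν x =
      besselK ν (x * Complex.exp (Real.pi * Complex.I / 4)) *
        besselK ν (x * Complex.exp (-(Real.pi * Complex.I / 4))) := by
  rw [kelvinPlus, kelvinMinus, mul_mul_mul_comm, ← Complex.exp_add, neg_add_cancel,
    Complex.exp_zero, one_mul]

theorem complexKernel_eq_besselKOnRay_mul (τ : ℂ) (x : ℝ) :
    complexKernel τ x =
      besselKOnRay (2 * Complex.I * τ) (Complex.exp (Real.pi * Complex.I / 4)) x *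
        besselKOnRay (2 * Complex.I * τ) (Complex.exp (-(Real.pi * Complex.I / 4))) x := by
  rw [complexKernel, ker_sq_add_kei_sq, kelvinPlus_mul_kelvinMinus, besselKOnRay, besselKOnRay]

theorem re_exp_pi_mul_I_div_four_pos : 0 < (Complex.exp (Real.pi * Complex.I / 4)).re := by
  simp [Complex.exp_re]

theorem re_exp_neg_pi_mul_I_div_four_pos : 0 < (Complex.exp (-(Real.pi * Complex.I / 4))).re := by
  simp [Complex.exp_re]

theorem exp_pi_mul_I_div_four_sq : Complex.exp (Real.pi * Complex.I / 4) ^ 2 = Complex.I := by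
  rw [← Complex.exp_nat_mul]
  refine Eq.trans (congrArg Complex.exp ?_) Complex.exp_pi_div_two_mul_I
  push_cast
  ring

theorem exp_neg_pi_mul_I_div_four_sq :
    Complex.exp (-(Real.pi * Complex.I / 4)) ^ 2 = -Complex.I := by
  rw [Complex.exp_neg, inv_pow, exp_pi_mul_I_div_four_sq, Complex.inv_I]

theorem contDiffOn_complexKernel (τ : ℂ) : ContDiffOn ℝ ω (complexKernel τ) (Ioi 0) := by
  simp only [funext (complexKernel_eq_besselKOnRay_mul τ)]
  exact (contDiffOn_besselKOnRay _ re_exp_pi_mul_I_div_four_pos).mul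
    (contDiffOn_besselKOnRay _ re_exp_neg_pi_mul_I_div_four_pos)

theorem sqrtOp_eulerOp_eulerOp_complexKernel (τ : ℂ) {x : ℝ} (hx : 0 < x) :
    sqrtOp (fun t => eulerOp (eulerOp (complexKernel τ)) t + τ ^ 2 * complexKernel τ t) x =
      complexKernel τ x / √x := by
  have hplus := re_exp_pi_mul_I_div_four_pos
  have hminus := re_exp_neg_pi_mul_I_div_four_pos
  simp only [funext (complexKernel_eq_besselKOnRay_mul τ)]
  rw [sqrtOp_eulerOp_eulerOp_mul (l := Complex.I / 2)
    ((contDiffOn_besselKOnRay _ hplus).of_le le_top)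
    ((contDiffOn_besselKOnRay _ hminus).of_le le_top) (fun t ht => ?_) (fun t ht => ?_) hx]
  · rw [div_pow, Complex.I_sq]
    ring
  · rw [eulerOp_eulerOp_besselKOnRay _ hplus ht, exp_pi_mul_I_div_four_sq, mul_pow, mul_pow,
      Complex.I_sq]
    ring
  · rw [eulerOp_eulerOp_besselKOnRay _ hminus ht, exp_neg_pi_mul_I_div_four_sq, mul_pow, mul_pow,
      Complex.I_sq]
    ring

end KelvinIndex

open KelvinIndex ContDiff in
theorem lemma2_general (τ : ℂ) :
    ContDiffOn ℝ ω (complexKernel τ) (Ioi 0) ∧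
    (∀ x : ℝ, 0 < x →
      (x : ℂ) ^ 3 * iteratedDeriv 4 (complexKernel τ) x
        + (11 / 2 : ℂ) * (x : ℂ) ^ 2 * iteratedDeriv 3 (complexKernel τ) x
        + (x : ℂ) * (11 / 2 + τ ^ 2) * iteratedDeriv 2 (complexKernel τ) x
        + (1 / 2 : ℂ) * (1 + τ ^ 2) * deriv (complexKernel τ) x
        - complexKernel τ x = 0) ∧
    (∀ x : ℝ, 0 < x →
      sqrtOp (fun t => eulerOp (eulerOp (complexKernel τ)) t + τ ^ 2 * complexKernel τ t) x
        = complexKernel τ x / (√x : ℂ)) := by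
  have hsmooth := contDiffOn_complexKernel τ
  refine ⟨hsmooth, fun x hx => ?_, fun x hx => sqrtOp_eulerOp_eulerOp_complexKernel τ hx⟩
  rw [← sqrt_mul_sqrtOp_eulerOp_eulerOp (hsmooth.of_le le_top) _ hx,
    sqrtOp_eulerOp_eulerOp_complexKernel τ hx, mul_div_cancel₀ _ (ofReal_sqrt_ne_zero hx), sub_self]

theorem lemma2 (τ : ℝ) :
    ContDiffOn ℝ 4 (fun x : ℝ => KelvinIndex.kernel x τ) (Set.Ioi 0) ∧
    (∀ x : ℝ, 0 < x →
      (x : ℂ) ^ 3 * iteratedDeriv 4 (fun t : ℝ => KelvinIndex.kernel t τ) x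
        + (11 / 2 : ℂ) * (x : ℂ) ^ 2 * iteratedDeriv 3 (fun t : ℝ => KelvinIndex.kernel t τ) x
        + (x : ℂ) * (11 / 2 + (τ : ℂ) ^ 2) *
            iteratedDeriv 2 (fun t : ℝ => KelvinIndex.kernel t τ) x
        + (1 / 2 : ℂ) * (1 + (τ : ℂ) ^ 2) * deriv (fun t : ℝ => KelvinIndex.kernel t τ) x
        - KelvinIndex.kernel x τ = 0) ∧
    (∀ x : ℝ, 0 < x →
      KelvinIndex.sqrtOp (fun t : ℝ =>
          KelvinIndex.eulerOp (KelvinIndex.eulerOp (fun u : ℝ => KelvinIndex.kernel u τ)) t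
            + (τ : ℂ) ^ 2 * KelvinIndex.kernel t τ) x
        = KelvinIndex.kernel x τ / (Real.sqrt x : ℂ)) := by
  obtain ⟨hsmooth, hode⟩ := lemma2_general τ
  exact ⟨hsmooth.of_le le_top, hode⟩
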